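/- Let $p$ be a prime, $k$ a field of characteristic $p$, and $G$ a finite group with $p \mid |G|$. **Definitions.** For a $G$-set $X$, let $G\ltimes X$ be its action groupoid (objects: the elements of $X$; morphisms $x\to x'$: the $g\in G$ with $gx=x'$), let $\mathrm{Rep}(X)$ be the category of functors from $G\ltimes X$ to $k$-vector spaces, with the pointwise tensor product, and let $\mathrm{StRep}(X)$ be the stable category: the same objects, with two morphisms identified when their difference factors through a projective object. Let $\mathrm{StPic}(X)$ be the group of isomorphism classes of $\otimes$-invertible objects of $\mathrm{StRep}(X)$. A $G$-map $\alpha:Y\to X$ induces $\alpha^*:\mathrm{StPic}(X)\to\mathrm{StPic}(Y)$ by composition with $G\ltimes Y\to G\ltimes X$. For a $G$-map $\alpha:U\to X$, write $\check H^0(\{U\to X\},\mathrm{StPic})\subseteq \mathrm{StPic}(U)$ for the degree-zero Čech cohomology group, that is, the kernel of $d^0=\mathrm{pr}_2^*/\mathrm{pr}_1^*:\mathrm{StPic}(U)\to\mathrm{StPic}(U\times_X U)$ (groups written multiplicatively). For a finite group $H$, let $T(H)$ be the group of isomorphism classes of $\otimes$-invertible objects of the stable category of finitely generated $kH$-modules.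 For $H\le G$ and $g\in G$, put $H[g]=H^g\cap H$ with $H^g=g^{-1}Hg$. Let $\mathrm{Res}^H_{H[g]}:T(H)\to T(H[g])$ be restriction, and let ${}^g\mathrm{Res}^H_{H[g]}:T(H)\to T(H[g])$ be $g$-twisted restriction, which keeps the vector space of a module and lets $x\in H[g]$ act as $gxg^{-1}\in H$. **Proposition.** Let $H\le G$ be a subgroup of index prime to $p$, and let $\mathcal U=\{G/H\to G/G\}$. The assignment $V\mapsto V_{[1]}$, the value of $V$ at the coset $[1]\in G/H$ with its action of $H$, induces an isomorphism of groups $\iota_H^*:\mathrm{StPic}(G/H)\to T(H)$. That is, there is a group isomorphism $\Phi:\mathrm{StPic}(G/H)\to T(H)$ such that $\Phi([V])$ and $V_{[1]}$ are isomorphic in the stable category of all $kH$-modules for every $\otimes$-invertible $V$ in $\mathrm{StRep}(G/H)$. Under this isomorphism the subgroup $\check H^0(\mathcal U,\mathrm{StPic})$ of $\mathrm{StPic}(G/H)$ is mapped onto $$\{\,w\in T(H)\;:\;\mathrm{Res}^H_{H[g]}(w)={}^g\mathrm{Res}^H_{H[g]}(w)\ \text{in } T(H[g])\ \text{for all } g\in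 G\,\}.$$ -/

import Mathlib

open CategoryTheory MonoidalCategory

universe v w u

namespace StablePic

section Stable

variable (C : Type w) [Category.{v} C] [Preadditive C]

/-- Two parallel morphisms are stably equal if their difference factors through a projective. -/
def stableRel : HomRel C := fun X Y f g =>
  ∃ (P : C) (_ : Projective P) (a : X ⟶ P) (b : P ⟶ Y), f - g = a ≫ b

/-- The stable category: the additive quotient of `C` by its projective objects. -/
abbrev StableCat := Quotient (stableRel C)

instance stableRel_congruence [Limits.HasBinaryBiproducts C] [Limits.HasZeroObject C] :
    Congruence (stableRel C) where
  equivalence := by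
    intro X Y
    refine ⟨fun f => ?_, ?_, ?_⟩
    · obtain ⟨Z, hZ⟩ := Limits.HasZeroObject.zero (C := C)
      exact ⟨Z, hZ.projective, 0, 0, by simp⟩
    · rintro f g ⟨P, hP, a, b, h⟩
      exact ⟨P, hP, -a, b, by rw [Preadditive.neg_comp, ← h, neg_sub]⟩
    · rintro f g h ⟨P, hP, a, b, e⟩ ⟨Q, hQ, a', b', e'⟩
      refine ⟨P ⊞ Q, inferInstance, Limits.biprod.lift a a', Limits.biprod.desc b b', ?_⟩
      rw [Limits.biprod.lift_desc, ← e, ← e', sub_add_sub_cancel]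
  comp_left := by
    rintro X Y Z f g g' ⟨P, hP, a, b, e⟩
    exact ⟨P, hP, f ≫ a, b, by rw [← Preadditive.comp_sub, e, Category.assoc]⟩
  comp_right := by
    rintro X Y Z f f' g ⟨P, hP, a, b, e⟩
    exact ⟨P, hP, a, b ≫ g, by rw [← Preadditive.sub_comp, e, Category.assoc]⟩

variable [MonoidalCategory C]

/-- The projective objects form a tensor ideal. -/
class ProjTensorIdeal : Prop where
  left (X P : C) (hP : Projective P) : Projective (X ⊗ P)
  right (P X : C) (hP : Projective P) : Projective (P ⊗ X)

variable [MonoidalPreadditive C] [ProjTensorIdeal C]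

variable {C}

/-- `X ⊗ -` on the stable category. -/
abbrev stableTensorLeft (X : C) : StableCat C ⥤ StableCat C :=
  CategoryTheory.Quotient.lift _ (tensorLeft X ⋙ Quotient.functor (stableRel C)) (by
    rintro Y Z f g ⟨P, hP, a, b, e⟩
    exact CategoryTheory.Quotient.sound _ ⟨X ⊗ P, ProjTensorIdeal.left X P hP, X ◁ a, X ◁ b, by
      rw [← MonoidalCategory.whiskerLeft_comp, ← e]
      exact ((tensorLeft X).map_sub (f := f) (g := g)).symm⟩)

/-- `- ⊗ X` on the stable category. -/
abbrev stableTensorRight (X : C) : StableCat C ⥤ StableCat C :=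
  CategoryTheory.Quotient.lift _ (tensorRight X ⋙ Quotient.functor (stableRel C)) (by
    rintro Y Z f g ⟨P, hP, a, b, e⟩
    exact CategoryTheory.Quotient.sound _ ⟨P ⊗ X, ProjTensorIdeal.right P X hP, a ▷ X, b ▷ X, by
      rw [← MonoidalCategory.comp_whiskerRight, ← e]
      exact ((tensorRight X).map_sub (f := f) (g := g)).symm⟩)

/-- The tensor product of the stable category is that of `C` on objects and on representatives
of morphisms. -/
instance : MonoidalCategoryStruct (StableCat C) where
  tensorObj X Y := ⟨X.as ⊗ Y.as⟩
  tensorUnit := ⟨𝟙_ C⟩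
  whiskerLeft X _ _ f := (stableTensorLeft X.as).map f
  whiskerRight f X := (stableTensorRight X.as).map f
  tensorHom {_ Y₁ X₂ _} f g := (stableTensorRight X₂.as).map f ≫ (stableTensorLeft Y₁.as).map g
  associator X Y Z := (Quotient.functor (stableRel C)).mapIso (α_ X.as Y.as Z.as)
  leftUnitor X := (Quotient.functor (stableRel C)).mapIso (λ_ X.as)
  rightUnitor X := (Quotient.functor (stableRel C)).mapIso (ρ_ X.as)

instance : MonoidalCategory (StableCat C) where
  tensorHom_def _ _ := rfl
  id_tensorHom_id X Y := congrArg (Quotient.functor (stableRel C)).map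
    (by simp : (𝟙 X.as ▷ Y.as) ≫ (X.as ◁ 𝟙 Y.as) = 𝟙 (X.as ⊗ Y.as))
  tensorHom_comp_tensorHom := by
    rintro _ _ _ _ _ _ ⟨f⟩ ⟨f'⟩ ⟨g⟩ ⟨g'⟩
    exact congrArg (Quotient.functor (stableRel C)).map
      (by simpa [MonoidalCategory.tensorHom_def] using tensorHom_comp_tensorHom f f' g g')
  whiskerLeft_id _ _ := congrArg (Quotient.functor (stableRel C)).map (whiskerLeft_id _ _)
  id_whiskerRight _ _ := congrArg (Quotient.functor (stableRel C)).map (id_whiskerRight _ _)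
  associator_naturality := by
    rintro ⟨X₁⟩ ⟨X₂⟩ ⟨X₃⟩ ⟨Y₁⟩ ⟨Y₂⟩ ⟨Y₃⟩ ⟨f : X₁ ⟶ Y₁⟩ ⟨g : X₂ ⟶ Y₂⟩ ⟨h : X₃ ⟶ Y₃⟩
    have e := associator_naturality f g h
    simp only [MonoidalCategory.tensorHom_def] at e
    exact congrArg (Quotient.functor (stableRel C)).map e
  leftUnitor_naturality := by
    rintro _ _ ⟨f⟩
    exact congrArg (Quotient.functor (stableRel C)).map (leftUnitor_naturality f)
  rightUnitor_naturality := by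
    rintro _ _ ⟨f⟩
    exact congrArg (Quotient.functor (stableRel C)).map (rightUnitor_naturality f)
  pentagon W X Y Z := congrArg (Quotient.functor (stableRel C)).map (pentagon W.as X.as Y.as Z.as)
  triangle X Y := congrArg (Quotient.functor (stableRel C)).map (triangle X.as Y.as)

instance [BraidedCategory C] : BraidedCategory (StableCat C) where
  braiding X Y := (Quotient.functor (stableRel C)).mapIso (β_ X.as Y.as)
  braiding_naturality_right := by
    rintro X _ _ ⟨f⟩
    exact congrArg (Quotient.functor (stableRel C)).map
      (BraidedCategory.braiding_naturality_right X.as f)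
  braiding_naturality_left := by
    rintro _ _ ⟨f⟩ Z
    exact congrArg (Quotient.functor (stableRel C)).map
      (BraidedCategory.braiding_naturality_left f Z.as)
  hexagon_forward X Y Z := congrArg (Quotient.functor (stableRel C)).map
    (BraidedCategory.hexagon_forward X.as Y.as Z.as)
  hexagon_reverse X Y Z := congrArg (Quotient.functor (stableRel C)).map
    (BraidedCategory.hexagon_reverse X.as Y.as Z.as)

end Stable

section StableMap

variable {C : Type*} [Category* C] [Preadditive C]
variable {D : Type*} [Category* D] [Preadditive D]

/-- The functor induced on stable categories by an additive functor preserving projectives. -/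
abbrev stableMap (F : C ⥤ D) [F.Additive] [F.PreservesProjectiveObjects] :
    StableCat C ⥤ StableCat D :=
  CategoryTheory.Quotient.lift _ (F ⋙ Quotient.functor (stableRel D)) (by
    rintro X Y f g ⟨P, hP, a, b, e⟩
    exact CategoryTheory.Quotient.sound _ ⟨F.obj P, F.projective_obj_of_projective hP, F.map a, F.map b, by
      rw [← F.map_sub, e, F.map_comp]⟩)

variable [MonoidalCategory C] [MonoidalPreadditive C] [ProjTensorIdeal C]
variable [MonoidalCategory D] [MonoidalPreadditive D] [ProjTensorIdeal D]

instance (F : C ⥤ D) [F.Additive] [F.PreservesProjectiveObjects] [F.Monoidal] :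
    (stableMap F).Monoidal :=
  Functor.CoreMonoidal.toMonoidal
    { εIso := (Quotient.functor (stableRel D)).mapIso (Functor.Monoidal.εIso F)
      μIso X Y := (Quotient.functor (stableRel D)).mapIso (Functor.Monoidal.μIso F X.as Y.as)
      μIso_hom_natural_left := by
        rintro _ _ ⟨f⟩ Z
        exact congrArg (Quotient.functor (stableRel D)).map
          (Functor.LaxMonoidal.μ_natural_left F f Z.as)
      μIso_hom_natural_right := by
        rintro _ _ Z ⟨f⟩
        exact congrArg (Quotient.functor (stableRel D)).map
          (Functor.LaxMonoidal.μ_natural_right F Z.as f)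
      associativity X Y Z := congrArg (Quotient.functor (stableRel D)).map
        (Functor.LaxMonoidal.associativity F X.as Y.as Z.as)
      left_unitality X := congrArg (Quotient.functor (stableRel D)).map
        (Functor.LaxMonoidal.left_unitality F X.as)
      right_unitality X := congrArg (Quotient.functor (stableRel D)).map
        (Functor.LaxMonoidal.right_unitality F X.as) }

end StableMap

section Pic

/-- The Picard group: isomorphism classes of `⊗`-invertible objects. -/
abbrev Pic (C : Type*) [Category* C] [MonoidalCategory C] [BraidedCategory C] := (Skeleton C)ˣ

variable {C : Type*} [Category* C] [MonoidalCategory C] [BraidedCategory C]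
variable {D : Type*} [Category* D] [MonoidalCategory D] [BraidedCategory D]

/-- The homomorphism `[V] ↦ [F V]` induced by a monoidal functor `F`. -/
noncomputable def Pic.map (F : C ⥤ D) [F.Monoidal] : Pic C →* Pic D :=
  Units.map (Skeleton.monoidHom F)

theorem Pic.map_injective (F : C ⥤ D) [F.Monoidal] [F.Full] [F.Faithful] :
    Function.Injective (Pic.map F) := by
  intro x y h
  have h' : F.mapSkeleton.obj x.1 = F.mapSkeleton.obj y.1 := congrArg Units.val h
  exact Units.ext (F.mapSkeleton_injective h')

end Pic

section Groupoid

variable (k : Type u) [Field k]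

theorem epi_split_moduleCat {M N : ModuleCat.{u} k} (f : M ⟶ N) [Epi f] : IsSplitEpi f := by
  have : Projective N := by
    have : Module.Projective k (N : Type u) := Module.Projective.of_free
    exact (IsProjective.iff_projective (R := k) (P := N)).1 this
  exact ⟨⟨⟨Projective.factorThru (𝟙 N) f, by simp⟩⟩⟩

variable {k}

theorem projective_tensor_functor {𝒢 : Type w} [Category.{v} 𝒢] [IsGroupoid 𝒢]
    (X P : 𝒢 ⥤ ModuleCat.{u} k) (hP : Projective P) : Projective (X ⊗ P) := by
  let _ : Groupoid 𝒢 := Groupoid.ofIsGroupoid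
  have : (ihom X).PreservesEpimorphisms := ⟨by
    intro A B f hf
    have : ∀ x, Epi (((ihom X).map f).app x) := by
      intro x
      have : IsSplitEpi (f.app x) := epi_split_moduleCat k _
      change Epi ((ihom (X.obj x)).map (f.app x))
      infer_instance
    exact NatTrans.epi_of_epi_app _⟩
  exact (ihom.adjunction X).map_projective P hP

instance {𝒢 : Type w} [Category.{v} 𝒢] : MonoidalPreadditive (𝒢 ⥤ ModuleCat.{u} k) where
  whiskerLeft_zero {X _ _} := NatTrans.ext (funext fun x =>
    MonoidalPreadditive.whiskerLeft_zero (X := X.obj x))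
  zero_whiskerRight {X _ _} := NatTrans.ext (funext fun x =>
    MonoidalPreadditive.zero_whiskerRight (X := X.obj x))
  whiskerLeft_add {X _ _} f g := NatTrans.ext (funext fun x =>
    MonoidalPreadditive.whiskerLeft_add (X := X.obj x) (f.app x) (g.app x))
  add_whiskerRight {X _ _} f g := NatTrans.ext (funext fun x =>
    MonoidalPreadditive.add_whiskerRight (X := X.obj x) (f.app x) (g.app x))

instance {𝒢 : Type w} [Category.{v} 𝒢] [IsGroupoid 𝒢] : ProjTensorIdeal (𝒢 ⥤ ModuleCat.{u} k) where
  left := projective_tensor_functor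
  right P X hP := Projective.of_iso (β_ X P) (projective_tensor_functor X P hP)

/-- If a groupoid acts freely on `T`, then the permutation representation `k[T]` is projective. -/
theorem projective_linearization {𝒢 : Type w} [Category.{v} 𝒢] [IsGroupoid 𝒢] (T : 𝒢 ⥤ Type u)
    (hT : ∀ {x y : 𝒢} (f g : x ⟶ y) (t : T.obj x), T.map f t = T.map g t → f = g) :
    Projective (T ⋙ ModuleCat.free k) := by
  refine ⟨fun {E B} f e he => ?_⟩
  have hsurj : ∀ x, Function.Surjective (e.app x).hom := fun x =>
    (ModuleCat.epi_iff_surjective _).1 inferInstance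
  let S : Setoid (Σ x, T.obj x) :=
    { r := fun p q => ∃ g : p.1 ⟶ q.1, T.map g p.2 = q.2
      iseqv :=
        { refl := fun p => ⟨𝟙 _, by simp⟩
          symm := by
            rintro ⟨x, s⟩ ⟨y, t⟩ ⟨g, h⟩
            dsimp at g h
            refine ⟨inv g, ?_⟩
            change T.map (inv g) t = s
            rw [← h, ← ConcreteCategory.comp_apply, ← T.map_comp, IsIso.hom_inv_id, T.map_id]
            rfl
          trans := by
            rintro ⟨x, s⟩ ⟨y, t⟩ ⟨z, r⟩ ⟨g, h⟩ ⟨g', h'⟩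
            dsimp at g h g' h'
            refine ⟨g ≫ g', ?_⟩
            change T.map (g ≫ g') s = r
            rw [T.map_comp, ConcreteCategory.comp_apply, h, h'] } }
  let rep : (Σ x, T.obj x) → (Σ x, T.obj x) := fun p => (Quotient.mk S p).out
  have hrep : ∀ p, ∃ g : (rep p).1 ⟶ p.1, T.map g (rep p).2 = p.2 := fun p => Quotient.mk_out p
  choose g hg using hrep
  choose l hl using fun p : (Σ x, T.obj x) => hsurj p.1 ((f.app p.1).hom (ModuleCat.freeMk p.2))
  have key : ∀ (r r' : Σ x, T.obj x), r = r' → ∀ {y} (a : r.1 ⟶ y) (b : r'.1 ⟶ y),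
      T.map a r.2 = T.map b r'.2 → (E.map a).hom (l r) = (E.map b).hom (l r') := by
    rintro r _ rfl y a b h
    rw [hT a b _ h]
  refine ⟨{ app := fun x => ModuleCat.freeDesc (↾fun t => (E.map (g ⟨x, t⟩)).hom (l (rep ⟨x, t⟩)))
            naturality := ?_ }, ?_⟩
  · intro x y h
    apply ModuleCat.free_hom_ext
    intro t
    have ht : rep ⟨y, T.map h t⟩ = rep ⟨x, t⟩ :=
      congrArg Quotient.out (Quotient.sound (s := S) (a := ⟨y, T.map h t⟩) (b := ⟨x, t⟩)
        (Setoid.symm' S ⟨h, rfl⟩))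
    have e1 := key _ _ ht (g ⟨y, T.map h t⟩) (g ⟨x, t⟩ ≫ h) (by
      rw [hg, T.map_comp, ConcreteCategory.comp_apply, hg])
    rw [E.map_comp] at e1
    rw [ConcreteCategory.comp_apply, ConcreteCategory.comp_apply, Functor.comp_map,
      ModuleCat.free_map_apply]
    erw [ModuleCat.freeDesc_apply, ModuleCat.freeDesc_apply]
    exact e1
  · apply NatTrans.ext
    funext x
    apply ModuleCat.free_hom_ext
    intro t
    rw [NatTrans.comp_app, ConcreteCategory.comp_apply]
    erw [ModuleCat.freeDesc_apply]
    have e1 := ConcreteCategory.congr_hom (e.naturality (g ⟨x, t⟩)) (l (rep ⟨x, t⟩))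
    have e2 := ConcreteCategory.congr_hom (f.naturality (g ⟨x, t⟩))
      (ModuleCat.freeMk (rep ⟨x, t⟩).2)
    rw [ConcreteCategory.comp_apply, ConcreteCategory.comp_apply] at e1 e2
    refine e1.trans ?_
    have e3 := hl (rep ⟨x, t⟩)
    refine (congrArg (B.map (g ⟨x, t⟩)) e3).trans (e2.symm.trans ?_)
    rw [Functor.comp_map, ModuleCat.free_map_apply, hg]

/-- Restriction along a faithful functor of groupoids preserves projective representations. -/
theorem projective_comp {𝒢 : Type w} [Category.{v} 𝒢] [IsGroupoid 𝒢] {ℋ : Type u} [Category.{u} ℋ] [IsGroupoid ℋ]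
    (F : 𝒢 ⥤ ℋ) [F.Faithful] (P : ℋ ⥤ ModuleCat.{u} k) (hP : Projective P) :
    Projective (F ⋙ P) := by
  let S : ℋ ⥤ Type u :=
    { obj := fun x => Σ y : ℋ, (y ⟶ x)
      map := fun f => ↾fun p => ⟨p.1, p.2 ≫ f⟩
      map_id := by
        intro x
        refine ConcreteCategory.hom_ext _ _ fun p => ?_
        exact congrArg (Sigma.mk (β := fun w : ℋ => (w ⟶ _)) p.1) (Category.comp_id p.2)
      map_comp := by
        intro x y z f g
        refine ConcreteCategory.hom_ext _ _ fun p => ?_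
        exact congrArg (Sigma.mk (β := fun w : ℋ => (w ⟶ _)) p.1) (Category.assoc p.2 f g).symm }
  let aug : (S ⋙ ModuleCat.free k) ⟶ 𝟙_ (ℋ ⥤ ModuleCat.{u} k) :=
    { app := fun x => ModuleCat.freeDesc (↾fun _ => (1 : k))
      naturality := by
        intro x y f
        apply ModuleCat.free_hom_ext
        intro t
        rw [ConcreteCategory.comp_apply, ConcreteCategory.comp_apply, Functor.comp_map,
          ModuleCat.free_map_apply]
        erw [ModuleCat.freeDesc_apply, ModuleCat.freeDesc_apply]
        rfl }
  have haug : ∀ x, Epi (aug.app x) := by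
    intro x
    refine (ModuleCat.epi_iff_surjective _).2 fun c => ?_
    refine ⟨c • ModuleCat.freeMk (⟨x, 𝟙 x⟩ : S.obj x), ?_⟩
    rw [map_smul]
    erw [ModuleCat.freeDesc_apply]
    exact mul_one (M := k) c
  have : Epi (P ◁ aug) := by
    have : ∀ x, Epi ((P ◁ aug).app x) := by
      intro x
      have := haug x
      have : IsSplitEpi (aug.app x) := epi_split_moduleCat k _
      change Epi ((tensorLeft (P.obj x)).map (aug.app x))
      infer_instance
    exact NatTrans.epi_of_epi_app _
  let q : P ⊗ (S ⋙ ModuleCat.free k) ⟶ P := P ◁ aug ≫ (ρ_ P).hom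
  have hF : Projective ((F ⋙ P) ⊗ ((F ⋙ S) ⋙ ModuleCat.free k)) := by
    apply projective_tensor_functor
    apply projective_linearization
    rintro x y f g ⟨z, t⟩ h
    have h' : (⟨z, t ≫ F.map f⟩ : Σ w : ℋ, (w ⟶ F.obj y)) = ⟨z, t ≫ F.map g⟩ := h
    have h'' : t ≫ F.map f = t ≫ F.map g := by simpa using h'
    exact F.map_injective ((cancel_epi t).1 h'')
  let s := Projective.factorThru (𝟙 P) q
  have hs : s ≫ q = 𝟙 P := Projective.factorThru_comp _ _
  refine ⟨fun {E B} f e he => ?_⟩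
  let s' : F ⋙ P ⟶ (F ⋙ P) ⊗ ((F ⋙ S) ⋙ ModuleCat.free k) := Functor.whiskerLeft F s
  let q' : (F ⋙ P) ⊗ ((F ⋙ S) ⋙ ModuleCat.free k) ⟶ F ⋙ P := Functor.whiskerLeft F q
  have hs' : s' ≫ q' = 𝟙 _ := by
    change Functor.whiskerLeft F (s ≫ q) = _
    rw [hs]; rfl
  refine ⟨s' ≫ Projective.factorThru (q' ≫ f) e, ?_⟩
  rw [Category.assoc, Projective.factorThru_comp, ← Category.assoc, hs', Category.id_comp]

end Groupoid

section RepGroup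
variable {k : Type u} [Field k] {H : Type v} [Group H]

theorem projective_tensor_rep (X P : Rep.{u} k H)
    (hP : Projective P) : Projective (X ⊗ P) := by
  have : (ihom X).PreservesEpimorphisms := ⟨by
    intro A B f hf
    rw [Rep.epi_iff_surjective] at hf ⊢
    intro (φ : X.V →ₗ[k] B.V)
    obtain ⟨ψ, hψ⟩ := Module.projective_lifting_property f.hom.toLinearMap φ hf
    exact ⟨ψ, hψ⟩⟩
  exact (ihom.adjunction X).map_projective P hP

instance : ProjTensorIdeal (Rep.{u} k H) where
  left := projective_tensor_rep
  right P X hP := Projective.of_iso (β_ X P) (projective_tensor_rep X P hP)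

end RepGroup

section Concrete

variable (k : Type u) [Field k] {G : Type u} [Group G]

/-- The functor `G ⋉ Y ⥤ G ⋉ X` of action groupoids induced by a `G`-map `α : Y → X`. -/
def actionMap {X Y : Type u} [MulAction G X] [MulAction G Y] (α : Y →[G] X) :
    ActionCategory G Y ⥤ ActionCategory G X where
  obj y := ((α y.back : X) : ActionCategory G X)
  map f := ⟨f.val, (map_smul α f.val _).symm.trans (congrArg α f.property)⟩

instance {X : Type u} [MulAction G X] : IsGroupoid (ActionCategory G X) where
  all_isIso {x y} f := ⟨⟨(f.val : G)⁻¹,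
      show (f.val : G)⁻¹ • y.back = x.back from inv_smul_eq_iff.2 f.property.symm⟩,
    Subtype.ext (inv_mul_cancel (f.val : G)), Subtype.ext (mul_inv_cancel (f.val : G))⟩

instance {X Y : Type u} [MulAction G X] [MulAction G Y] (α : Y →[G] X) :
    (actionMap α).Faithful where
  map_injective {_ _ a b} h := by
    have h' : ((actionMap α).map a).val = ((actionMap α).map b).val := by rw [h]
    exact Subtype.ext h'

variable (G) in
/-- Representations of the `G`-set `X`: functors from the action groupoid `G ⋉ X` to `k`-vector
spaces, with the pointwise tensor product. -/
abbrev GRep (X : Type u) [MulAction G X] := ActionCategory G X ⥤ ModuleCat.{u} k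

/-- `α^* : Rep X ⥤ Rep Y`. -/
abbrev GRep.pullback {X Y : Type u} [MulAction G X] [MulAction G Y] (α : Y →[G] X) :
    GRep k G X ⥤ GRep k G Y :=
  (Functor.whiskeringLeft _ _ _).obj (actionMap α)

instance {X Y : Type u} [MulAction G X] [MulAction G Y] (α : Y →[G] X) :
    (GRep.pullback k α).PreservesProjectiveObjects where
  projective_obj hP := projective_comp (actionMap α) _ hP

instance {X Y : Type u} [MulAction G X] [MulAction G Y] (α : Y →[G] X) :
    (GRep.pullback k α).Additive where


/-! ### Restriction -/

section Res
variable {K H : Type u} [Group K] [Group H]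

noncomputable instance (φ : K →* H) : (Rep.resFunctor.{u} (k := k) φ).Monoidal :=
  Functor.CoreMonoidal.toMonoidal
    { εIso := Iso.refl _
      μIso _ _ := Iso.refl _
      associativity X Y Z := Rep.hom_ext <| Representation.IntertwiningMap.ext <|
        TensorProduct.ext_threefold fun _ _ _ => rfl
      left_unitality X := Rep.hom_ext <| Representation.IntertwiningMap.ext <|
        TensorProduct.ext' fun _ _ => rfl
      right_unitality X := Rep.hom_ext <| Representation.IntertwiningMap.ext <|
        TensorProduct.ext' fun _ _ => rfl }

theorem preservesProjective_res_equiv (e : K ≃* H) :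
    (Rep.resFunctor.{u} (k := k) e.toMonoidHom).PreservesProjectiveObjects := by
  have : (Rep.resFunctor.{u} (k := k) e.symm.toMonoidHom).PreservesEpimorphisms := inferInstance
  let adj : Rep.resFunctor.{u} (k := k) e.toMonoidHom ⊣ Rep.resFunctor.{u} (k := k) e.symm.toMonoidHom :=
    Adjunction.mkOfHomEquiv
      { homEquiv X Y :=
         { toFun f := Rep.ofHom ⟨f.hom.toLinearMap, fun g => by
              have := f.hom.2 (e.symm g); simpa using this⟩
           invFun f := Rep.ofHom ⟨f.hom.toLinearMap, fun g => by
              have := f.hom.2 (e g); simpa using this⟩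
           left_inv _ := rfl
           right_inv _ := rfl } }
  exact Functor.preservesProjectiveObjects_of_adjunction_of_preservesEpimorphisms adj

theorem preservesProjective_res (φ : K →* H) (hφ : Function.Injective φ) :
    (Rep.resFunctor.{u} (k := k) φ).PreservesProjectiveObjects where
  projective_obj {P} hP := by
    have := preservesProjective_res_equiv k (MonoidHom.ofInjective hφ)
    exact Functor.projective_obj_of_projective (Rep.resFunctor.{u} (k := k) (MonoidHom.ofInjective hφ).toMonoidHom)
      (Functor.projective_obj_of_projective (Rep.resFunctor.{u} (k := k) φ.range.subtype) hP)

end Res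

section Iota

variable (H : Subgroup G)

/-- The base point `[1]` of `G ⋉ G/H`. -/
def basePt : ActionCategory G (G ⧸ H) := (((1 : G) : G ⧸ H) : ActionCategory G (G ⧸ H))

/-- `h ∈ H` as an automorphism of the base point. -/
def baseAut (h : H) : basePt H ⟶ basePt H :=
  ⟨h.1, show h.1 • ((1 : G) : G ⧸ H) = ((1 : G) : G ⧸ H) by
    exact QuotientGroup.eq.2 (by simp)⟩

/-- `ι_H^*`: `V ↦ V_[1]` with its action of `H`. -/
def iotaStar : GRep k G (G ⧸ H) ⥤ Rep.{u} k H where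
  obj V := Rep.of (X := V.obj (basePt H))
    { toFun := fun h => (V.map (baseAut H h)).hom
      map_one' := by
        have : baseAut H 1 = 𝟙 _ := rfl
        rw [this, V.map_id]; rfl
      map_mul' := fun a b => by
        have : baseAut H (a * b) = baseAut H b ≫ baseAut H a := rfl
        rw [this, V.map_comp]; rfl }
  map f := Rep.ofHom ⟨(f.app (basePt H)).hom, fun h => by
    have := congrArg ModuleCat.Hom.hom (f.naturality (baseAut H h))
    exact this⟩

instance : (iotaStar k H).Additive where

/-- The equivalence between functors on the one-object groupoid of `H` and `H`-representations. -/
noncomputable abbrev singleObjEquiv : (SingleObj H ⥤ ModuleCat.{u} k) ≌ Rep.{u} k H :=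
  (Action.functorCategoryEquivalence (ModuleCat.{u} k) H).symm.trans (Rep.repIsoAction k H).symm

/-- The inclusion of the one-object groupoid of `H` in `G ⋉ G/H`. -/
def iota : SingleObj H ⥤ ActionCategory G (G ⧸ H) where
  obj _ := basePt H
  map h := baseAut H h

instance : (iota H).Faithful where
  map_injective {_ _ a b} h := by
    have h' : ((iota H).map a).val = ((iota H).map b).val := by rw [h]
    exact Subtype.ext h'

instance : (iotaStar k H).PreservesProjectiveObjects where
  projective_obj {P} hP := by
    have h1 := ((singleObjEquiv k H).map_projective_iff (iota H ⋙ P)).2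
      (projective_comp (iota H) P hP)
    exact h1

noncomputable instance : (iotaStar k H).Monoidal :=
  Functor.CoreMonoidal.toMonoidal
    { εIso := Iso.refl _
      μIso _ _ := Iso.refl _
      associativity X Y Z := Rep.hom_ext <| Representation.IntertwiningMap.ext <|
        TensorProduct.ext_threefold fun _ _ _ => rfl
      left_unitality X := Rep.hom_ext <| Representation.IntertwiningMap.ext <|
        TensorProduct.ext' fun _ _ => rfl
      right_unitality X := Rep.hom_ext <| Representation.IntertwiningMap.ext <|
        TensorProduct.ext' fun _ _ => rfl }

end Iota


section SP

/-- The stable category of representations. -/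
abbrev StRep (G : Type u) [Group G] (X : Type u) [MulAction G X] := StableCat (GRep k G X)

/-- The Picard group `StPic X` of the stable category of representations of the `G`-set `X`. -/
abbrev StPic (G : Type u) [Group G] (X : Type u) [MulAction G X] := Pic (StRep k G X)

/-- `α^* : StPic X → StPic Y` for a `G`-map `α : Y → X`. -/
noncomputable def StPic.pullback {X Y : Type u} [MulAction G X] [MulAction G Y] (α : Y →[G] X) :
    StPic k G X →* StPic k G Y :=
  Pic.map (stableMap (GRep.pullback k α))

/-- The stable category of all `kH`-modules. -/
abbrev StMod (H : Type u) [Group H] := StableCat (Rep.{u} k H)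

/-- The property of being (represented by) a finitely generated, that is, finite-dimensional
`kH`-module. -/
def fg (H : Type u) [Group H] : ObjectProperty (StMod k H) := fun V => Module.Finite k V.as.V

instance (H : Type u) [Group H] : (fg k H).IsMonoidal where
  prop_unit := inferInstanceAs (Module.Finite k k)
  prop_tensor X Y hX hY := by
    have : Module.Finite k X.as.V := hX
    have : Module.Finite k Y.as.V := hY
    exact inferInstanceAs (Module.Finite k (TensorProduct k X.as.V Y.as.V))

/-- The stable category of finitely generated `kH`-modules, as a full subcategory of `StMod k H`. -/
abbrev FGStMod (H : Type u) [Group H] := (fg k H).FullSubcategory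

/-- `T(H)`: the group of stable isomorphism classes of `⊗`-invertible finitely generated
`kH`-modules (endotrivial modules). -/
abbrev T (H : Type u) [Group H] := Pic (FGStMod k H)

/-- The homomorphism induced by the inclusion of finitely generated modules in all modules. -/
noncomputable def T.incl (H : Type u) [Group H] : T k H →* Pic (StMod k H) := Pic.map (fg k H).ι

theorem T.incl_injective (H : Type u) [Group H] : Function.Injective (T.incl k H) :=
  Pic.map_injective _

/-- The homomorphism induced by `ι_H^*`, that is, `[V] ↦ [V_[1]]`. -/
noncomputable def StPic.iotaStar (H : Subgroup G) : StPic k G (G ⧸ H) →* Pic (StMod k H) :=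
  Pic.map (stableMap (StablePic.iotaStar k H))

variable {K H : Type u} [Group K] [Group H]

/-- Restriction along an injective group homomorphism `φ : K → H`, on the stable categories of
finitely generated modules. -/
def fgRes (φ : K →* H) (hφ : Function.Injective φ) : FGStMod k H ⥤ FGStMod k K :=
  have := preservesProjective_res k φ hφ
  (fg k K).lift ((fg k H).ι ⋙ stableMap (Rep.resFunctor φ)) fun V => V.2

noncomputable instance (φ : K →* H) (hφ : Function.Injective φ) : (fgRes k φ hφ).Monoidal :=
  have := preservesProjective_res k φ hφ
  Functor.CoreMonoidal.toMonoidal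
    { εIso := (fg k K).isoMk (Functor.Monoidal.εIso ((fg k H).ι ⋙ stableMap (Rep.resFunctor φ)))
      μIso X Y := (fg k K).isoMk
        (Functor.Monoidal.μIso ((fg k H).ι ⋙ stableMap (Rep.resFunctor φ)) X Y)
      μIso_hom_natural_left f Z := ObjectProperty.hom_ext _ <|
        Functor.LaxMonoidal.μ_natural_left ((fg k H).ι ⋙ stableMap (Rep.resFunctor φ)) f Z
      μIso_hom_natural_right Z f := ObjectProperty.hom_ext _ <|
        Functor.LaxMonoidal.μ_natural_right ((fg k H).ι ⋙ stableMap (Rep.resFunctor φ)) Z f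
      associativity X Y Z := ObjectProperty.hom_ext _ <|
        Functor.LaxMonoidal.associativity ((fg k H).ι ⋙ stableMap (Rep.resFunctor φ)) X Y Z
      left_unitality X := ObjectProperty.hom_ext _ <|
        Functor.LaxMonoidal.left_unitality ((fg k H).ι ⋙ stableMap (Rep.resFunctor φ)) X
      right_unitality X := ObjectProperty.hom_ext _ <|
        Functor.LaxMonoidal.right_unitality ((fg k H).ι ⋙ stableMap (Rep.resFunctor φ)) X }

/-- Restriction `T(H) → T(K)` along an injective group homomorphism `φ : K → H`. -/
noncomputable def T.res (φ : K →* H) (hφ : Function.Injective φ) : T k H →* T k K :=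
  Pic.map (fgRes k φ hφ)

end SP

section Twisted

/-- Conjugation `x ↦ g x g⁻¹` as a homomorphism `K → H`, for subgroups with `g K g⁻¹ ≤ H`. -/
def conjHom (H K : Subgroup G) (g : G) (h : ∀ x ∈ K, g * x * g⁻¹ ∈ H) : K →* H :=
  ((MulAut.conj g).toMonoidHom.comp K.subtype).codRestrict H fun x => h x.1 x.2

theorem conjHom_injective (H K : Subgroup G) (g : G) (h : ∀ x ∈ K, g * x * g⁻¹ ∈ H) :
    Function.Injective (conjHom H K g h) := fun _ _ e =>
  Subtype.ext ((MulAut.conj g).injective (congrArg Subtype.val e))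

/-- The `g`-twisted restriction `T(H) → T(K)`: `x ∈ K` acts on the restricted module as
`g x g⁻¹ ∈ H`. -/
noncomputable def T.twistedRes (H K : Subgroup G) (g : G) (h : ∀ x ∈ K, g * x * g⁻¹ ∈ H) :
    T k H →* T k K :=
  T.res k (conjHom H K g h) (conjHom_injective H K g h)

/-- `H[g] = H^g ∩ H`, where `H^g = g⁻¹ H g = {x | g x g⁻¹ ∈ H}`. -/
def conjInter (H : Subgroup G) (g : G) : Subgroup G :=
  H.comap (MulAut.conj g).toMonoidHom ⊓ H

theorem conjInter_le (H : Subgroup G) (g : G) : conjInter H g ≤ H := inf_le_right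

theorem conj_mem_of_mem_conjInter (H : Subgroup G) (g : G) :
    ∀ x ∈ conjInter H g, g * x * g⁻¹ ∈ H := fun _ hx => hx.1

end Twisted

section Cech

variable {U X : Type u} [MulAction G U] [MulAction G X]

/-- The fibre product `U ×_X U` of `G`-sets, with the diagonal action. -/
def FiberSq (α : U →[G] X) : Type u := {q : U × U // α q.1 = α q.2}

instance (α : U →[G] X) : MulAction G (FiberSq α) where
  smul g q := ⟨g • q.1, by
    change α (g • q.1.1) = α (g • q.1.2)
    rw [map_smul, map_smul, q.2]⟩
  one_smul q := Subtype.ext (one_smul G q.1)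
  mul_smul a b q := Subtype.ext (mul_smul a b q.1)

/-- The first projection `U ×_X U → U`. -/
def pr₁ (α : U →[G] X) : FiberSq α →[G] U where
  toFun q := q.1.1
  map_smul' _ _ := rfl

/-- The second projection `U ×_X U → U`. -/
def pr₂ (α : U →[G] X) : FiberSq α →[G] U where
  toFun q := q.1.2
  map_smul' _ _ := rfl

/-- The differential `d⁰ : StPic U → StPic (U ×_X U)` of the Čech complex of `α : U → X` with
coefficients in `StPic`: the alternating sum of the maps induced by the two projections, written
multiplicatively. -/
noncomputable def cechD0 (α : U →[G] X) : StPic k G U →* StPic k G (FiberSq α) :=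
  StPic.pullback k (pr₂ α) / StPic.pullback k (pr₁ α)

/-- The Čech cohomology group `Ȟ⁰({U → X}, StPic)`: the degree zero cohomology of the Čech complex
`0 → StPic U → StPic (U ×_X U) → ⋯`, as a subgroup of `StPic U`. -/
noncomputable def cechH0 (α : U →[G] X) : Subgroup (StPic k G U) := (cechD0 k α).ker

end Cech

/-- The projection of `G`-sets `G/H → G/G`. -/
def toPoint (H : Subgroup G) : G ⧸ H →[G] G ⧸ (⊤ : Subgroup G) where
  toFun := Subgroup.quotientMapOfLE le_top
  map_smul' _ x := QuotientGroup.induction_on x fun _ => rfl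

end Concrete

end StablePic

/-!
Evaluation at the coset `[1]` is an equivalence between representations of the `G`-set `G/H` and
representations of `H`, because `H` is the vertex group of the connected groupoid `G ⋉ G/H` at `[1]`.
An additive equivalence induces an equivalence of stable categories (`stableMap_isEquivalence`), so
`StPic(G/H)` is the Picard group of the stable category of all `kH`-modules
(`StPic.iotaStar_bijective`).

That this Picard group is `T(H)` (`T.incl_bijective`) means that an invertible `kH`-module `X`, with
inverse `Y`, is stably isomorphic to a finite-dimensional one. The isomorphism `k ⟶ X ⊗ Y` sends `1`
to a finite sum of pure tensors, so it factors through `V ⊗ Y` for a finite-dimensional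
subrepresentation `V` of `X` (`exists_finite_subrep_factor`). Tensoring this factorization with `X`
makes `X` a stable retract of `V ⊗ Y ⊗ X ≅ V` (`exists_retract`). If `X ⟶ V ⟶ X` is such a stable
retraction, the endomorphism `x` of `V` given by `V ⟶ X ⟶ V` is bijective on the image `W` of a
large power `x ^ n`. The composite `X ⟶ V ⟶ W ⟶ V ⟶ X` is stably the identity and
`W ⟶ V ⟶ X ⟶ V ⟶ W` is an automorphism, hence `X` and `W` are stably isomorphic
(`fg_of_stable_retract`).

A class `[V]` lies in `Ȟ⁰` if and only if `pr₁^* V` and `pr₂^* V` are stably isomorphic over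
`G/H × G/H`. A stable isomorphism of representations of a groupoid may be tested on vertex groups
meeting every connected component (`stable_iso_of_vertex_groups`): up to equivalence the groupoid is
the disjoint union of one such vertex group for each component, and over a disjoint union morphisms
and projectives are given piecewise. Every orbit of `G/H × G/H` contains a point `([1], [g⁻¹])`, with
stabilizer `H[g]`. There `pr₁^* V` is the restriction of `V_[1]`, and `pr₂^* V` is `V_[g⁻¹]`, which
`g : V_[g⁻¹] ⟶ V_[1]` identifies with the `g`-twisted restriction (`pairEvalPr₁`, `pairEvalPr₂`).
-/

namespace StablePic

/-! ### Stable categories of equivalent categories -/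

section StableEquivalence

variable {C : Type*} [Category* C] [Preadditive C] [Limits.HasBinaryBiproducts C]
  [Limits.HasZeroObject C]

theorem stable_map_eq_iff {X Y : C} (f g : X ⟶ Y) :
    (Quotient.functor (stableRel C)).map f = (Quotient.functor (stableRel C)).map g ↔
      stableRel C f g :=
  Quotient.functor_map_eq_iff _ _ _

variable {D : Type*} [Category* D] [Preadditive D] [Limits.HasBinaryBiproducts D]
  [Limits.HasZeroObject D]

/-- Projectivity passes along equivalences, so an additive equivalence both preserves and reflects
the relation of stable equality. -/
theorem stableMap_isEquivalence (F : C ⥤ D) [F.Additive] [F.PreservesProjectiveObjects]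
    [F.IsEquivalence] : (stableMap F).IsEquivalence where
  faithful :=
    { map_injective := by
        rintro X Y ⟨f⟩ ⟨g⟩ h
        obtain ⟨P, hP, a, b, e⟩ := (stable_map_eq_iff (F.map f) (F.map g)).1 h
        let q : F.obj (F.objPreimage P) ≅ P := F.objObjPreimageIso P
        have hP' : Projective (F.objPreimage P) :=
          (F.asEquivalence.map_projective_iff _).1 (Projective.of_iso q.symm hP)
        refine (stable_map_eq_iff f g).2
          ⟨F.objPreimage P, hP', F.preimage (a ≫ q.inv), F.preimage (q.hom ≫ b), F.map_injective ?_⟩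
        simpa using e }
  full :=
    { map_surjective := by
        rintro X Y ⟨f⟩
        exact ⟨(Quotient.functor _).map (F.preimage f),
          congrArg (Quotient.functor (stableRel D)).map (F.map_preimage f)⟩ }
  essSurj :=
    { mem_essImage := fun Y => ⟨⟨F.objPreimage Y.as⟩,
        ⟨(Quotient.functor (stableRel D)).mapIso (F.objObjPreimageIso Y.as)⟩⟩ }

end StableEquivalence

/-! ### Picard groups and retracts from invertibility -/

section Pic

variable {C : Type*} [Category* C] [MonoidalCategory C] [BraidedCategory C]
variable {D : Type*} [Category* D] [MonoidalCategory D] [BraidedCategory D]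

theorem Pic.map_bijective (F : C ⥤ D) [F.Monoidal] [F.IsEquivalence] :
    Function.Bijective (Pic.map F) := by
  have hF : Function.Bijective (Skeleton.monoidHom F) :=
    ⟨F.mapSkeleton_injective, F.mapSkeleton_surjective⟩
  exact (Units.mapEquiv (MulEquiv.ofBijective (Skeleton.monoidHom F) hF)).bijective

theorem Pic.val_map {F : C ⥤ D} [F.Monoidal] {w : Pic C} {X : C} (hX : w.1 = toSkeleton X) :
    (Pic.map F w).1 = toSkeleton (F.obj X) := by
  change F.mapSkeleton.obj w.1 = _
  rw [hX, Functor.mapSkeleton_obj_toSkeleton]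

theorem Pic.exists_rep (w : Pic C) : ∃ X : C, w.1 = toSkeleton X :=
  ⟨(fromSkeleton C).obj w.1, (toSkeleton_fromSkeleton_obj _).symm⟩

theorem Pic.exists_inverse {w : Pic C} {X : C} (hX : w.1 = toSkeleton X) :
    ∃ Y : C, w⁻¹.1 = toSkeleton Y ∧ Nonempty (X ⊗ Y ≅ 𝟙_ C) := by
  obtain ⟨Y, hY⟩ := Pic.exists_rep w⁻¹
  refine ⟨Y, hY, toSkeleton_eq_toSkeleton_iff.1 ?_⟩
  rw [Skeleton.toSkeleton_tensorObj, ← hX, ← hY, ← Skeleton.one_eq]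
  exact w.mul_inv

/-- An object representing an element of the Picard group is a retract of every object through
which the unit factors as `𝟙 ⟶ V ⊗ Y ⟶ X ⊗ Y ≅ 𝟙`. -/
theorem exists_retract {X Y V : C} (e : X ⊗ Y ≅ 𝟙_ C) (t : 𝟙_ C ⟶ V ⊗ Y) (j : V ⟶ X)
    [IsIso (t ≫ j ▷ Y)] : ∃ (i : X ⟶ V) (r : V ⟶ X), i ≫ r = 𝟙 X := by
  -- `φ Z : (Z ⊗ Y) ⊗ X ≅ Z` is natural in `Z`
  let φ (Z : C) : (Z ⊗ Y) ⊗ X ≅ Z := α_ Z Y X ≪≫ whiskerLeftIso Z (β_ Y X ≪≫ e) ≪≫ ρ_ Z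
  have hφ : (j ▷ Y) ▷ X ≫ (φ X).hom = (φ V).hom ≫ j := by
    simp only [φ, Iso.trans_hom, whiskerLeftIso_hom, Category.assoc]
    rw [associator_naturality_left_assoc, ← rightUnitor_naturality, whisker_exchange_assoc]
  let i : X ⟶ V := (λ_ X).inv ≫ t ▷ X ≫ (φ V).hom
  have hi : i ≫ j = (λ_ X).inv ≫ (t ≫ j ▷ Y) ▷ X ≫ (φ X).hom := by
    simp [i, hφ]
  have : IsIso (i ≫ j) := by rw [hi]; infer_instance
  exact ⟨i, j ≫ inv (i ≫ j), by rw [← Category.assoc, IsIso.hom_inv_id]⟩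

end Pic

/-! ### The value at the base point -/

section Iota

variable (k : Type u) [Field k] {G : Type u} [Group G] (H : Subgroup G)

instance : (iota H).Full where
  map_surjective {_ _} f := ⟨⟨f.1, by
    have h : f.1 • ((1 : G) : G ⧸ H) = ((1 : G) : G ⧸ H) := f.2
    simpa using QuotientGroup.eq.1 h.symm⟩, rfl⟩

instance : (iota H).EssSurj where
  mem_essImage x := by
    obtain ⟨g, hg⟩ := MulAction.exists_smul_eq G ((1 : G) : G ⧸ H) x.back
    exact ⟨SingleObj.star H, ⟨@asIso _ _ _ _ (⟨g, hg⟩ : basePt H ⟶ x) (IsGroupoid.all_isIso _)⟩⟩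

instance : (iota H).IsEquivalence where

/-- The one-object groupoid of `H` is the full subgroupoid of the connected groupoid `G ⋉ G/H` at the
base point, so restricting to it loses nothing. -/
instance : (iotaStar k H).IsEquivalence := by
  have : ((Functor.whiskeringLeft _ _ (ModuleCat.{u} k)).obj (iota H)).IsEquivalence :=
    inferInstance
  have h : ((Functor.whiskeringLeft _ _ (ModuleCat.{u} k)).obj (iota H) ⋙
    (singleObjEquiv k H).functor).IsEquivalence := inferInstance
  exact h

theorem StPic.iotaStar_bijective : Function.Bijective (StPic.iotaStar k H) :=
  have := stableMap_isEquivalence (StablePic.iotaStar k H)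
  Pic.map_bijective _

end Iota

/-! ### Invertible modules are stably finite-dimensional -/

section FiniteDimensional

variable {k : Type u} [Field k] {H : Type u} [Group H]

/-- A stable retract of a finite-dimensional representation `V` is stably isomorphic to a
finite-dimensional one, namely to the stable image of the induced endomorphism of `V`. -/
theorem fg_of_stable_retract (X V : Rep.{u} k H) [Module.Finite k V.V] (i : X ⟶ V) (r : V ⟶ X)
    (h : (Quotient.functor (stableRel (Rep.{u} k H))).map (i ≫ r) = 𝟙 _) :
    ∃ W : StMod k H, fg k H W ∧ Nonempty ((⟨X⟩ : StMod k H) ≅ W) := by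
  let Q := Quotient.functor (stableRel (Rep.{u} k H))
  let x : Module.End k V.V := (r ≫ i).hom.toLinearMap
  obtain ⟨n, hn⟩ : ∃ n, ∀ m, n ≤ m → LinearMap.range (x ^ n) = LinearMap.range (x ^ m) :=
    IsArtinian.monotone_stabilizes x.iterateRange
  have hx : ∀ (g : H) (m : ℕ) (v : V.V), (x ^ m) (V.ρ g v) = V.ρ g ((x ^ m) v) := by
    intro g m v
    induction m with
    | zero => rfl
    | succ m ih =>
      rw [pow_succ', Module.End.mul_apply, Module.End.mul_apply, ih]
      exact Rep.hom_comm_apply (r ≫ i) g _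
  let W : Rep.{u} k H := V.subrepresentation (LinearMap.range (x ^ n)) (by
    rintro g _ ⟨v, rfl⟩
    exact ⟨V.ρ g v, hx g n v⟩)
  let incl : W ⟶ V := V.subtype _ _
  let pr : V ⟶ W := Rep.ofHom ⟨(x ^ n).rangeRestrict, fun g => LinearMap.ext fun v =>
    Subtype.ext (hx g n v)⟩
  let a : W ⟶ X := incl ≫ r
  let b : X ⟶ W := i ≫ pr
  -- `b ≫ a = i ≫ (r ≫ i) ^ n ≫ r` is stably the identity
  have key : ∀ m : ℕ, ∀ f : V ⟶ V, f.hom.toLinearMap = x ^ m → Q.map (i ≫ f ≫ r) = 𝟙 _ := by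
    intro m
    induction m with
    | zero =>
      intro f hf
      have : f = 𝟙 V := Rep.hom_ext <| Representation.IntertwiningMap.ext hf
      rw [this, Category.id_comp]
      exact h
    | succ m ih =>
      intro f hf
      let f' : V ⟶ V := Rep.ofHom ⟨x ^ m, fun g => LinearMap.ext fun v => hx g m v⟩
      have e : f = f' ≫ r ≫ i := by
        refine Rep.hom_ext <| Representation.IntertwiningMap.ext ?_
        rw [hf, pow_succ']
        rfl
      have e' : i ≫ f ≫ r = (i ≫ f' ≫ r) ≫ (i ≫ r) := by simp [e]
      rw [e', Q.map_comp, ih f' rfl]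
      exact (Category.id_comp _).trans h
  have hba : Q.map b ≫ Q.map a = 𝟙 _ := by
    rw [← Q.map_comp]
    have e : b ≫ a = i ≫ (pr ≫ incl) ≫ r := by simp [a, b]
    rw [e]
    exact key n _ rfl
  -- `a ≫ b` is the restriction of `x ^ (n + 1)` to its stable image
  have hab : IsIso (a ≫ b) := by
    have hfin : Module.Finite k W.V :=
      inferInstanceAs (Module.Finite k (LinearMap.range (x ^ n)))
    have hsurj : Function.Surjective (a ≫ b).hom.toLinearMap := by
      rintro ⟨y, hy⟩
      have hy' := hy
      rw [hn (n + (1 + n)) (by omega)] at hy'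
      obtain ⟨z, hz⟩ := hy'
      refine ⟨⟨(x ^ n) z, ⟨z, rfl⟩⟩, Subtype.ext ?_⟩
      rw [pow_add, pow_add, pow_one] at hz
      exact hz
    have hinj := LinearMap.injective_iff_surjective.2 hsurj
    have h1 : Epi (a ≫ b) := (Rep.epi_iff_surjective _).2 hsurj
    have h2 : Mono (a ≫ b) := (Rep.mono_iff_injective _).2 hinj
    exact isIso_of_mono_of_epi _
  have hab' : IsIso (Q.map a ≫ Q.map b) := by
    rw [← Q.map_comp]; infer_instance
  refine ⟨⟨W⟩, inferInstanceAs (Module.Finite k (LinearMap.range (x ^ n))), ?_⟩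
  have : IsSplitEpi (Q.map a) := ⟨⟨⟨Q.map b, hba⟩⟩⟩
  have : Mono (Q.map a) := mono_of_mono (Q.map a) (Q.map b)
  have : IsIso (Q.map a) := isIso_of_mono_of_isSplitEpi _
  exact ⟨(asIso (Q.map a)).symm⟩

variable [Finite H]

/-- An invariant element of `X ⊗ Y` lies in `V ⊗ Y` for a finite-dimensional subrepresentation
`V` of `X`. -/
theorem exists_finite_subrep_factor (X Y : Rep.{u} k H) (t : 𝟙_ (Rep.{u} k H) ⟶ X ⊗ Y) :
    ∃ (V : Rep.{u} k H) (j : V ⟶ X) (t' : 𝟙_ (Rep.{u} k H) ⟶ V ⊗ Y),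
      Module.Finite k V.V ∧ t' ≫ j ▷ Y = t := by
  let τ : TensorProduct k X.V Y.V := t.hom (1 : k)
  have hτ : ∀ g, TensorProduct.map (X.ρ g) (Y.ρ g) τ = τ := fun g =>
    (Rep.hom_comm_apply t g (1 : k)).symm
  obtain ⟨M, hM, hM'⟩ :=
    TensorProduct.exists_finite_submodule_left_of_setFinite {τ} (Set.finite_singleton τ)
  let N : Submodule k X.V := ⨆ g : H, M.map (X.ρ g)
  have hN : ∀ g, N ≤ N.comap (X.ρ g) := by
    intro g
    refine iSup_le fun g' => ?_
    rintro _ ⟨v, hv, rfl⟩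
    refine Submodule.mem_iSup_of_mem (g * g') ⟨v, hv, ?_⟩
    rw [map_mul]; rfl
  have hMN : M ≤ N := fun v hv => Submodule.mem_iSup_of_mem 1 ⟨v, hv, by rw [map_one]; rfl⟩
  have hNfin : Module.Finite k N := inferInstance
  have hτN : τ ∈ LinearMap.range (N.subtype.rTensor Y.V) := by
    obtain ⟨σ, hσ⟩ := hM' rfl
    refine ⟨(Submodule.inclusion hMN).rTensor Y.V σ, ?_⟩
    rw [← LinearMap.rTensor_comp_apply, Submodule.subtype_comp_inclusion]
    exact hσ
  obtain ⟨σ, hσ⟩ := hτN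
  have hinj : Function.Injective (N.subtype.rTensor Y.V) :=
    Module.Flat.rTensor_preserves_injective_linearMap _ N.injective_subtype
  let V := X.subrepresentation N hN
  let j : V ⟶ X := X.subtype N hN
  have hσ' : ∀ g, (V ⊗ Y).ρ g σ = σ := by
    intro g
    apply hinj
    exact (Rep.hom_comm_apply (j ▷ Y) g σ).trans
      ((congrArg ((X ⊗ Y).ρ g) hσ).trans ((hτ g).trans hσ.symm))
  refine ⟨V, j, Rep.ofHom ⟨LinearMap.toSpanSingleton k _ σ, fun g => LinearMap.ext_ring ?_⟩,
    hNfin, ?_⟩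
  · change (1 : k) • σ = (V ⊗ Y).ρ g ((1 : k) • σ)
    rw [one_smul, hσ']
  · refine Rep.hom_ext <| Representation.IntertwiningMap.ext <| LinearMap.ext_ring ?_
    change N.subtype.rTensor Y.V ((1 : k) • σ) = τ
    rw [one_smul, hσ]

/-- An invertible object of the stable category of all modules is stably isomorphic to a
finite-dimensional module. -/
theorem fg_of_invertible {X Y : StMod k H} (e : X ⊗ Y ≅ 𝟙_ (StMod k H)) :
    ∃ W : StMod k H, fg k H W ∧ Nonempty (X ≅ W) := by
  let Q := Quotient.functor (stableRel (Rep.{u} k H))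
  obtain ⟨t, ht⟩ : ∃ t : 𝟙_ (Rep.{u} k H) ⟶ X.as ⊗ Y.as, Q.map t = e.inv := Q.map_surjective e.inv
  obtain ⟨V, j, t', hV, h⟩ := exists_finite_subrep_factor X.as Y.as t
  have hiso : IsIso ((Q.map t' : 𝟙_ (StMod k H) ⟶ (⟨V⟩ : StMod k H) ⊗ Y) ≫
      (Q.map j : (⟨V⟩ : StMod k H) ⟶ X) ▷ Y) := by
    have : (Q.map t' : 𝟙_ (StMod k H) ⟶ (⟨V⟩ : StMod k H) ⊗ Y) ≫
        (Q.map j : (⟨V⟩ : StMod k H) ⟶ X) ▷ Y = e.inv :=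
      (Q.map_comp t' (j ▷ Y.as)).symm.trans ((congrArg Q.map h).trans ht)
    rw [this]; infer_instance
  obtain ⟨i, r, hir⟩ := exists_retract e
    (Q.map t' : 𝟙_ (StMod k H) ⟶ (⟨V⟩ : StMod k H) ⊗ Y) (Q.map j : (⟨V⟩ : StMod k H) ⟶ X)
  obtain ⟨i, rfl⟩ := Q.map_surjective i
  obtain ⟨r, rfl⟩ := Q.map_surjective r
  exact fg_of_stable_retract X.as V i r ((Q.map_comp i r).trans hir)

variable (k H) in
theorem T.incl_bijective : Function.Bijective (T.incl k H) := by
  refine ⟨T.incl_injective k H, fun w => ?_⟩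
  have hfg : ∀ w : Pic (StMod k H), ∃ W : FGStMod k H, w.1 = toSkeleton W.obj := by
    intro w
    obtain ⟨X, hX⟩ := Pic.exists_rep w
    obtain ⟨Y, -, ⟨e⟩⟩ := Pic.exists_inverse hX
    obtain ⟨W, hW, ⟨f⟩⟩ := fg_of_invertible e
    exact ⟨⟨W, hW⟩, hX.trans (congr_toSkeleton_of_iso f)⟩
  obtain ⟨V, hV⟩ := hfg w
  obtain ⟨W, hW⟩ := hfg w⁻¹
  have hinj := (fg k H).ι.mapSkeleton_injective
  have hV' : Skeleton.monoidHom (fg k H).ι (toSkeleton V) = w.1 :=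
    ((fg k H).ι.mapSkeleton_obj_toSkeleton V).trans hV.symm
  have hW' : Skeleton.monoidHom (fg k H).ι (toSkeleton W) = w⁻¹.1 :=
    ((fg k H).ι.mapSkeleton_obj_toSkeleton W).trans hW.symm
  have h1 : toSkeleton V * toSkeleton W = 1 := hinj <| by
    change Skeleton.monoidHom (fg k H).ι _ = Skeleton.monoidHom (fg k H).ι _
    rw [map_mul, map_one, hV', hW', w.mul_inv]
  exact ⟨⟨toSkeleton V, toSkeleton W, h1, (mul_comm _ _).trans h1⟩, Units.ext hV'⟩

end FiniteDimensional

/-! ### Gluing stable isomorphisms over a groupoid -/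

section Gluing

variable {k : Type u} [Field k]

section Sigma

variable {I : Type*} {C : I → Type*} [∀ i, Category* (C i)]

/-- Projectivity of a representation of a disjoint union can be tested on the pieces. -/
theorem projective_sigma (P : (Σ i, C i) ⥤ ModuleCat.{u} k)
    (hP : ∀ i, Projective (Sigma.incl i ⋙ P)) : Projective P := by
  refine ⟨fun {E B} f e he => ?_⟩
  have hepi : ∀ i, Epi (Functor.whiskerLeft (Sigma.incl i) e) := fun i => by
    have : ∀ x, Epi ((Functor.whiskerLeft (Sigma.incl i) e).app x) := fun x =>
      inferInstanceAs (Epi (e.app _))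
    exact NatTrans.epi_of_epi_app _
  refine ⟨Sigma.natTrans fun i => Projective.factorThru (Functor.whiskerLeft (Sigma.incl i) f)
    (Functor.whiskerLeft (Sigma.incl i) e), NatTrans.ext (funext ?_)⟩
  rintro ⟨i, x⟩
  exact NatTrans.congr_app (Projective.factorThru_comp (Functor.whiskerLeft (Sigma.incl i) f)
    (Functor.whiskerLeft (Sigma.incl i) e)) x

theorem stableRel_sigma {V W : (Σ i, C i) ⥤ ModuleCat.{u} k} (f g : V ⟶ W)
    (h : ∀ i, stableRel (C i ⥤ ModuleCat.{u} k) (Functor.whiskerLeft (Sigma.incl i) f)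
      (Functor.whiskerLeft (Sigma.incl i) g)) :
    stableRel ((Σ i, C i) ⥤ ModuleCat.{u} k) f g := by
  choose P hP a b e using h
  refine ⟨Sigma.desc P, projective_sigma _ hP, Sigma.natTrans (G := Sigma.desc P) a,
    Sigma.natTrans (F := Sigma.desc P) b, NatTrans.ext (funext ?_)⟩
  rintro ⟨i, x⟩
  exact NatTrans.congr_app (e i) x

/-- Stable isomorphisms on the pieces of a disjoint union glue. -/
theorem stable_iso_sigma (V W : (Σ i, C i) ⥤ ModuleCat.{u} k)
    (h : ∀ i, Nonempty ((⟨Sigma.incl i ⋙ V⟩ : StableCat (C i ⥤ ModuleCat.{u} k)) ≅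
      ⟨Sigma.incl i ⋙ W⟩)) :
    Nonempty ((⟨V⟩ : StableCat ((Σ i, C i) ⥤ ModuleCat.{u} k)) ≅ ⟨W⟩) := by
  have h' : ∀ i, ∃ (f : Sigma.incl i ⋙ V ⟶ Sigma.incl i ⋙ W)
      (g : Sigma.incl i ⋙ W ⟶ Sigma.incl i ⋙ V),
      stableRel _ (f ≫ g) (𝟙 _) ∧ stableRel _ (g ≫ f) (𝟙 _) := by
    intro i
    obtain ⟨e⟩ := h i
    obtain ⟨f, hf⟩ := (Quotient.functor (stableRel (C i ⥤ ModuleCat.{u} k))).map_surjective e.hom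
    obtain ⟨g, hg⟩ := (Quotient.functor (stableRel (C i ⥤ ModuleCat.{u} k))).map_surjective e.inv
    refine ⟨f, g, (stable_map_eq_iff _ _).1 ?_, (stable_map_eq_iff _ _).1 ?_⟩
    · rw [Functor.map_comp, hf, hg]; exact e.hom_inv_id
    · rw [Functor.map_comp, hf, hg]; exact e.inv_hom_id
  choose f g hfg hgf using h'
  exact ⟨⟨(Quotient.functor _).map (Sigma.natTrans f), (Quotient.functor _).map (Sigma.natTrans g),
    (stable_map_eq_iff _ _).2 (stableRel_sigma (Sigma.natTrans f ≫ Sigma.natTrans g) (𝟙 V) hfg),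
    (stable_map_eq_iff _ _).2 (stableRel_sigma (Sigma.natTrans g ≫ Sigma.natTrans f) (𝟙 W) hgf)⟩⟩

theorem sigma_desc_isEquivalence {𝒢 : Type*} [Category* 𝒢] (F : ∀ i, C i ⥤ 𝒢)
    [∀ i, (F i).Full] [∀ i, (F i).Faithful]
    (hdisj : ∀ i j (c : C i) (d : C j), Nonempty ((F i).obj c ⟶ (F j).obj d) → i = j)
    (hsurj : ∀ x : 𝒢, ∃ (i : I) (c : C i), Nonempty ((F i).obj c ≅ x)) :
    (Sigma.desc F).IsEquivalence where
  faithful :=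
    { map_injective := by
        rintro ⟨i, c⟩ ⟨_, d⟩ ⟨f⟩ ⟨g⟩ h
        exact congrArg Sigma.SigmaHom.mk ((F i).map_injective h) }
  full :=
    { map_surjective := by
        rintro ⟨i, c⟩ ⟨j, d⟩ f
        obtain rfl := hdisj i j c d ⟨f⟩
        exact ⟨Sigma.SigmaHom.mk ((F i).preimage f), (F i).map_preimage f⟩ }
  essSurj :=
    { mem_essImage := fun x => by
        obtain ⟨i, c, e⟩ := hsurj x
        exact ⟨⟨i, c⟩, e⟩ }

end Sigma

/-- A stable isomorphism of representations of a groupoid can be tested on a family of vertex groups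
that meets every connected component. -/
theorem stable_iso_of_vertex_groups {𝒢 : Type*} [Category* 𝒢] [IsGroupoid 𝒢] {I : Type*}
    {K : I → Type*} [∀ i, Group (K i)] (F : ∀ i, SingleObj (K i) ⥤ 𝒢)
    [∀ i, (F i).Full] [∀ i, (F i).Faithful]
    (hsurj : ∀ x : 𝒢, ∃ i, Nonempty ((F i).obj (SingleObj.star _) ⟶ x))
    (V W : 𝒢 ⥤ ModuleCat.{u} k)
    (h : ∀ i, Nonempty ((⟨F i ⋙ V⟩ : StableCat (SingleObj (K i) ⥤ ModuleCat.{u} k)) ≅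
      ⟨F i ⋙ W⟩)) :
    Nonempty ((⟨V⟩ : StableCat (𝒢 ⥤ ModuleCat.{u} k)) ≅ ⟨W⟩) := by
  -- one vertex group for each connected component
  let S : Setoid I :=
    { r i j := Nonempty ((F i).obj (SingleObj.star _) ⟶ (F j).obj (SingleObj.star _))
      iseqv :=
        { refl i := ⟨𝟙 _⟩
          symm := fun ⟨f⟩ => ⟨inv f⟩
          trans := fun ⟨f⟩ ⟨g⟩ => ⟨f ≫ g⟩ } }
  let F' (j : Quotient S) := F j.out
  have hF' : (Sigma.desc F').IsEquivalence := by
    refine sigma_desc_isEquivalence F' (fun i j _ _ hij => ?_) (fun x => ?_)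
    · rw [← i.out_eq, ← j.out_eq]
      exact Quotient.sound hij
    · obtain ⟨i, ⟨f⟩⟩ := hsurj x
      obtain ⟨g⟩ : Nonempty ((F (Quotient.mk S i).out).obj (SingleObj.star _) ⟶
        (F i).obj (SingleObj.star _)) := Quotient.mk_out i
      exact ⟨Quotient.mk S i, SingleObj.star _, ⟨asIso (g ≫ f)⟩⟩
  let R := (Functor.whiskeringLeft _ _ (ModuleCat.{u} k)).obj (Sigma.desc F')
  have : R.PreservesProjectiveObjects :=
    ⟨fun hP => (R.asEquivalence.map_projective_iff _).2 hP⟩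
  have : R.Additive := { }
  have := stableMap_isEquivalence R
  obtain ⟨e⟩ := stable_iso_sigma (R.obj V) (R.obj W) fun j => h j.out
  exact ⟨(stableMap R).preimageIso e⟩

end Gluing

/-! ### The fibre square of `G/H` -/

section Double

variable (k : Type u) [Field k] {G : Type u} [Group G] (H : Subgroup G)

/-- The point `([1], [g⁻¹])` of `G/H × G/H`, whose stabilizer is `H[g]`. -/
def pairPt (g : G) : FiberSq (toPoint H) :=
  ⟨(((1 : G) : G ⧸ H), ((g⁻¹ : G) : G ⧸ H)), by
    have : Subsingleton (G ⧸ (⊤ : Subgroup G)) := QuotientGroup.subsingleton_quotient_top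
    exact Subsingleton.elim _ _⟩

theorem smul_pairPt_eq_iff (g x : G) :
    x • pairPt H g = pairPt H g ↔ x ∈ conjInter H g := by
  have h1 : ((x * 1 : G) : G ⧸ H) = ((1 : G) : G ⧸ H) ↔ x ∈ H := by
    rw [eq_comm, QuotientGroup.eq]; simp
  have h2 : ((x * g⁻¹ : G) : G ⧸ H) = ((g⁻¹ : G) : G ⧸ H) ↔ g * x * g⁻¹ ∈ H := by
    rw [eq_comm, QuotientGroup.eq]; simp [mul_assoc]
  refine (Subtype.ext_iff.trans Prod.ext_iff).trans ((and_congr h1 h2).trans ?_)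
  exact and_comm

theorem exists_smul_pairPt (q : FiberSq (toPoint H)) : ∃ g x : G, x • pairPt H g = q := by
  obtain ⟨⟨a, b⟩, hq⟩ := q
  induction a using QuotientGroup.induction_on with | H a => ?_
  induction b using QuotientGroup.induction_on with | H b => ?_
  refine ⟨b⁻¹ * a, a, Subtype.ext (Prod.ext ?_ ?_)⟩
  · change ((a * 1 : G) : G ⧸ H) = a
    rw [mul_one]
  · change ((a * (b⁻¹ * a)⁻¹ : G) : G ⧸ H) = b
    congr 1; group

/-- The inclusion of the vertex group `H[g]` at the point `([1], [g⁻¹])`. -/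
def pairIncl (g : G) : SingleObj (conjInter H g) ⥤ ActionCategory G (FiberSq (toPoint H)) where
  obj _ := (pairPt H g : ActionCategory G (FiberSq (toPoint H)))
  map x := ⟨x.1, (smul_pairPt_eq_iff H g x.1).2 x.2⟩

instance (g : G) : (pairIncl H g).Faithful where
  map_injective {_ _ a b} h := by
    have h' : ((pairIncl H g).map a).val = ((pairIncl H g).map b).val := by rw [h]
    exact Subtype.ext h'

instance (g : G) : (pairIncl H g).Full where
  map_surjective {_ _} f := ⟨⟨f.1, (smul_pairPt_eq_iff H g f.1).1 f.2⟩, rfl⟩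

/-- The value at `([1], [g⁻¹])`, as a representation of `H[g]`. -/
noncomputable abbrev pairEval (g : G) :
    GRep k G (FiberSq (toPoint H)) ⥤ Rep.{u} k (conjInter H g) :=
  (Functor.whiskeringLeft _ _ _).obj (pairIncl H g) ⋙ (singleObjEquiv k (conjInter H g)).functor

/-- The value of `pr₁^* V` at `([1], [g⁻¹])` is the restriction of `V_[1]` to `H[g]`. -/
noncomputable def pairEvalPr₁ (g : G) (V : GRep k G (G ⧸ H)) :
    (pairEval k H g).obj ((GRep.pullback k (pr₁ (toPoint H))).obj V) ≅
      (Rep.resFunctor (Subgroup.inclusion (conjInter_le H g))).obj ((iotaStar k H).obj V) :=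
  Iso.refl _

/-- The morphism `[g⁻¹] ⟶ [1]` of `G ⋉ G/H` given by `g`. -/
def toBasePt (g : G) :
    (pairIncl H g ⋙ actionMap (pr₂ (toPoint H))).obj (SingleObj.star _) ⟶ basePt H :=
  ⟨g, show ((g * g⁻¹ : G) : G ⧸ H) = ((1 : G) : G ⧸ H) by rw [mul_inv_cancel]⟩

/-- The value of `pr₂^* V` at `([1], [g⁻¹])` is `V_[g⁻¹]`, which the action of `g` identifies with
the `g`-twisted restriction of `V_[1]` to `H[g]`. -/
noncomputable def pairEvalPr₂ (g : G) (V : GRep k G (G ⧸ H)) :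
    (pairEval k H g).obj ((GRep.pullback k (pr₂ (toPoint H))).obj V) ≅
      (Rep.resFunctor (conjHom H (conjInter H g) g (conj_mem_of_mem_conjInter H g))).obj
        ((iotaStar k H).obj V) :=
  Rep.mkIso (Representation.Equiv.mk
    (V.mapIso (asIso (toBasePt H g))).toLinearEquiv fun x => by
      let c : ((iota H).obj (SingleObj.star _) ⟶ (iota H).obj (SingleObj.star _)) :=
        baseAut H (conjHom H (conjInter H g) g (conj_mem_of_mem_conjInter H g) x)
      let y := (pairIncl H g ⋙ actionMap (pr₂ (toPoint H))).map
        (X := SingleObj.star _) (Y := SingleObj.star _) x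
      have e : y ≫ toBasePt H g = toBasePt H g ≫ c :=
        Subtype.ext (show g * x.1 = g * x.1 * g⁻¹ * g by group)
      have e' : V.map y ≫ V.map (toBasePt H g) = V.map (toBasePt H g) ≫ V.map c :=
        (V.map_comp _ _).symm.trans ((congrArg V.map e).trans (V.map_comp _ _))
      exact congrArg ModuleCat.Hom.hom e')

instance (K : Subgroup G) : (singleObjEquiv k K).functor.Additive where
  map_add := rfl

instance (K : Subgroup G) : (singleObjEquiv k K).functor.PreservesProjectiveObjects where
  projective_obj hP := ((singleObjEquiv k K).map_projective_iff _).2 hP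

instance (g : G) : (pairEval k H g).PreservesProjectiveObjects where
  projective_obj {P} hP := ((singleObjEquiv k _).map_projective_iff _).2
    (projective_comp (pairIncl H g) P hP)

instance (g : G) : (pairEval k H g).Additive where
  map_add := rfl

/-- Stable isomorphism over `G/H × G/H` can be tested at the points `([1], [g⁻¹])`, since these meet
every orbit. -/
theorem stable_iso_fiberSq_iff (V W : GRep k G (FiberSq (toPoint H))) :
    Nonempty ((⟨V⟩ : StRep k G (FiberSq (toPoint H))) ≅ ⟨W⟩) ↔
      ∀ g, Nonempty ((⟨(pairEval k H g).obj V⟩ : StMod k (conjInter H g)) ≅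
        ⟨(pairEval k H g).obj W⟩) := by
  refine ⟨fun ⟨e⟩ g => ⟨(stableMap (pairEval k H g)).mapIso e⟩, fun h => ?_⟩
  refine stable_iso_of_vertex_groups (pairIncl H) (fun x => ?_) V W fun g => ?_
  · obtain ⟨g, x', hx⟩ := exists_smul_pairPt H x.back
    exact ⟨g, ⟨⟨x', hx⟩⟩⟩
  · obtain ⟨e⟩ := h g
    have := stableMap_isEquivalence (singleObjEquiv k (conjInter H g)).functor
    exact ⟨(stableMap (singleObjEquiv k (conjInter H g)).functor).preimageIso e⟩

/-- The restriction of `w ∈ T(L)` is represented by the restriction of any `kL`-module, possibly of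
infinite dimension, that represents `w`. -/
theorem T.incl_res_val {K L : Type u} [Group K] [Group L] (φ : K →* L)
    (hφ : Function.Injective φ) (w : T k L) (X : StMod k L)
    (hX : (T.incl k L w).1 = toSkeleton X) :
    (T.incl k K (T.res k φ hφ w)).1 = toSkeleton (⟨(Rep.resFunctor φ).obj X.as⟩ : StMod k K) := by
  obtain ⟨A, hA⟩ := Pic.exists_rep w
  have h1 : (T.incl k L w).1 = toSkeleton ((fg k L).ι.obj A) := Pic.val_map hA
  have h2 : (T.incl k K (T.res k φ hφ w)).1 =
      toSkeleton ((fg k K).ι.obj ((fgRes k φ hφ).obj A)) := Pic.val_map (Pic.val_map hA)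
  obtain ⟨e⟩ := toSkeleton_eq_toSkeleton_iff.1 (h1.symm.trans hX)
  have := preservesProjective_res k φ hφ
  exact h2.trans (congr_toSkeleton_of_iso ((stableMap (Rep.resFunctor φ)).mapIso e))

/-- Membership in `Ȟ⁰` is a stable isomorphism `pr₂^* V ≅ pr₁^* V` over `G/H × G/H`; tested at the
points `([1], [g⁻¹])` it becomes the equality of the two restrictions to `H[g]`. -/
theorem mem_cechH0_iff (w : StPic k G (G ⧸ H)) (w' : T k H)
    (hw : T.incl k H w' = StPic.iotaStar k H w) :
    w ∈ cechH0 k (toPoint H) ↔ ∀ g : G,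
      T.res k (Subgroup.inclusion (conjInter_le H g)) (Subgroup.inclusion_injective _) w' =
        T.twistedRes k H (conjInter H g) g (conj_mem_of_mem_conjInter H g) w' := by
  obtain ⟨⟨V⟩, hV⟩ := Pic.exists_rep w
  have hV' : (T.incl k H w').1 = toSkeleton (⟨(iotaStar k H).obj V⟩ : StMod k H) := by
    rw [hw]; exact Pic.val_map hV
  have h0 : w ∈ cechH0 k (toPoint H) ↔
      StPic.pullback k (pr₂ (toPoint H)) w = StPic.pullback k (pr₁ (toPoint H)) w := by
    rw [cechH0, MonoidHom.mem_ker, cechD0, MonoidHom.div_apply, div_eq_one]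
  have h1 : (StPic.pullback k (pr₁ (toPoint H)) w).1 =
      toSkeleton (⟨(GRep.pullback k (pr₁ (toPoint H))).obj V⟩ : StRep k G _) := Pic.val_map hV
  have h2 : (StPic.pullback k (pr₂ (toPoint H)) w).1 =
      toSkeleton (⟨(GRep.pullback k (pr₂ (toPoint H))).obj V⟩ : StRep k G _) := Pic.val_map hV
  rw [h0, Units.ext_iff, h1, h2, toSkeleton_eq_toSkeleton_iff, stable_iso_fiberSq_iff]
  refine forall_congr' fun g => ?_
  have hr := T.incl_res_val k (Subgroup.inclusion (conjInter_le H g))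
    (Subgroup.inclusion_injective _) w' _ hV'
  have ht := T.incl_res_val k (conjHom H (conjInter H g) g (conj_mem_of_mem_conjInter H g))
    (conjHom_injective H _ g _) w' _ hV'
  rw [T.twistedRes, ← (T.incl_injective k _).eq_iff, Units.ext_iff, hr, ht,
    toSkeleton_eq_toSkeleton_iff]
  let e₁ := (Quotient.functor (stableRel (Rep.{u} k (conjInter H g)))).mapIso (pairEvalPr₁ k H g V)
  let e₂ := (Quotient.functor (stableRel (Rep.{u} k (conjInter H g)))).mapIso (pairEvalPr₂ k H g V)
  exact ⟨fun ⟨e⟩ => ⟨e₁.symm ≪≫ e.symm ≪≫ e₂⟩, fun ⟨e⟩ => ⟨e₂ ≪≫ e.symm ≪≫ e₁.symm⟩⟩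

end Double
end StablePic

theorem mainTheorem11 {k : Type u} [Field k] (p : ℕ) [Fact p.Prime] [CharP k p]
    {G : Type u} [Group G] [Finite G] (hpG : p ∣ Nat.card G)
    (H : Subgroup G) (hH : Nat.Coprime H.index p) :
    ∃ Φ : StablePic.StPic k G (G ⧸ H) ≃* StablePic.T k H,
      (∀ w, StablePic.T.incl k H (Φ w) = StablePic.StPic.iotaStar k H w) ∧
      Φ '' (StablePic.cechH0 k (StablePic.toPoint H) : Set (StablePic.StPic k G (G ⧸ H))) =
        {w : StablePic.T k H | ∀ g : G,
          StablePic.T.res k (Subgroup.inclusion (StablePic.conjInter_le H g))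
              (Subgroup.inclusion_injective _) w =
            StablePic.T.twistedRes k H (StablePic.conjInter H g) g
              (StablePic.conj_mem_of_mem_conjInter H g) w} := by
  let Ψ := MulEquiv.ofBijective _ (StablePic.T.incl_bijective k H)
  let Φ := (MulEquiv.ofBijective _ (StablePic.StPic.iotaStar_bijective k H)).trans Ψ.symm
  have hΦ : ∀ w, StablePic.T.incl k H (Φ w) = StablePic.StPic.iotaStar k H w :=
    fun w => Ψ.apply_symm_apply _
  refine ⟨Φ, hΦ, Set.ext fun w => ⟨?_, fun hw => ⟨Φ.symm w, ?_, Φ.apply_symm_apply w⟩⟩⟩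
  · rintro ⟨v, hv, rfl⟩
    exact (StablePic.mem_cechH0_iff k H v _ (hΦ v)).1 hv
  · refine (StablePic.mem_cechH0_iff k H (Φ.symm w) w ?_).2 hw
    rw [← hΦ, Φ.apply_symm_apply]
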